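/- Let $\mathbb{S}_d^+\subset M_d(\mathbb{R})$ be the cone of symmetric positive semidefinite real $d\times d$ matrices and let $\|\cdot\|$ be any norm on $M_d(\mathbb{R})$. Let $L=(L_t)_{t\ge 0}$ be a matrix subordinator, i.e. a Lévy process with values in the symmetric real $d\times d$ matrices such that $L_t-L_s\in\mathbb{S}_d^+$ almost surely for all $t>s$. Let $\gamma_L\in\mathbb{S}_d^+$ be its drift and $\kappa_L$ its Lévy measure, so that $\kappa_L$ is concentrated on $\mathbb{S}_d^+$, $\kappa_L(\{0\})=0$, $\int\min(1,\|X\|^2)\,\kappa_L(dX)<\infty$, $\int_{\{\|X\|\le 1\}}\|X\|\,\kappa_L(dX)<\infty$, and \[ E\big[e^{i\,\mathrm{tr}(ZL_1)}\big]=\exp\Big(i\,\mathrm{tr}(\gamma_L Z)+\int_{\mathbb{S}_d^+}\big(e^{i\,\mathrm{tr}(XZ)}-1\big)\,\kappa_L(dX)\Big),\qquad Z\in M_d(\mathbb{R}). \] Let \[ \Theta_L(Z)=\mathrm{tr}(\gamma_L Z)+\int_{\mathbb{S}_d^+}\big(e^{\mathrm{tr}(XZ)}-1\big)\,\kappa_L(dX)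 \] be the cumulant transform of $L$, defined for those $Z\in M_d(\mathbb{C})$ for which the integral converges absolutely; this includes all $Z\in iM_d(\mathbb{R})$. Let $\epsilon>0$ and \[ S_\epsilon:=\{Z\in M_d(\mathbb{C}):\|\Re Z\|<\epsilon\}-\mathbb{S}_d^+=\{W-P:\ W\in M_d(\mathbb{C}),\ \|\Re W\|<\epsilon,\ P\in\mathbb{S}_d^+\}, \] where $\Re$ is taken entrywise. Then $S_\epsilon$ is open and convex, and the following are equivalent: \begin{enumerate} \item $\Theta_L$ is analytic on $S_\epsilon$, i.e. the integral defining $\Theta_L(Z)$ converges absolutely for every $Z\in S_\epsilon$, and $\Theta_L$ is analytic on $S_\epsilon$; \item the restriction of $\Theta_L$ to $iM_d(\mathbb{R})$ extends to an analytic function on $S_\epsilon$; \item $\displaystyle\int_{\{\|X\|\ge 1\}}e^{\mathrm{tr}(RX)}\,\kappa_L(dX)<\infty$ for all $R\in M_d(\mathbb{R})$ with $\|R\|<\epsilon$. \end{enumerate} -/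

import Mathlib

open MeasureTheory ProbabilityTheory Filter Topology
open scoped NNReal ENNReal Pointwise

/-- Real square matrices carry their Borel sigma-algebra. -/
instance matrixMeasurableSpace (d : ℕ) : MeasurableSpace (Matrix (Fin d) (Fin d) ℝ) :=
  borel _

instance matrixBorelSpace (d : ℕ) : BorelSpace (Matrix (Fin d) (Fin d) ℝ) := ⟨rfl⟩

-- Matrices are normed by the Frobenius norm, wherever Mathlib asks for some norm.
attribute [local instance] Matrix.frobeniusNormedAddCommGroup Matrix.frobeniusNormedSpace

/-- A Lévy process with values in `E`, indexed by `[0, ∞)`. -/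
structure IsLevyProcess {Ω E : Type*} [MeasurableSpace Ω] [NormedAddCommGroup E]
    [MeasurableSpace E] (L : ℝ≥0 → Ω → E) (P : Measure Ω) : Prop where
  measurable : ∀ t, Measurable (L t)
  start_zero : ∀ᵐ ω ∂P, L 0 ω = 0
  indep_increments : HasIndepIncrements L P
  stationary_increments : ∀ s t : ℝ≥0,
    IdentDistrib (fun ω => L (s + t) ω - L s ω) (fun ω => L t ω - L 0 ω) P P
  stochastically_continuous : ∀ t, TendstoInMeasure P L (𝓝 t) (L t)
  /-- Almost all paths are right-continuous with left limits. -/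
  cadlag : ∀ᵐ ω ∂P, ∀ t : ℝ≥0,
    ContinuousWithinAt (fun s => L s ω) (Set.Ici t) t ∧
      ∃ l : E, Tendsto (fun s => L s ω) (𝓝[<] t) (𝓝 l)

/-- A matrix subordinator: a Lévy process of symmetric matrices with positive semidefinite
increments. -/
structure IsMatrixSubordinator {d : ℕ} {Ω : Type*} [MeasurableSpace Ω]
    (L : ℝ≥0 → Ω → Matrix (Fin d) (Fin d) ℝ) (P : Measure Ω) : Prop where
  isLevyProcess : IsLevyProcess L P
  symm : ∀ t ω, (L t ω).IsSymm
  increments : ∀ s t : ℝ≥0, s < t → ∀ᵐ ω ∂P, (L t ω - L s ω).PosSemidef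

noncomputable section

/-- A real matrix regarded as a complex one. -/
def toComplexMatrix {d : ℕ} (X : Matrix (Fin d) (Fin d) ℝ) : Matrix (Fin d) (Fin d) ℂ :=
  X.map (fun x => (x : ℂ))

/-- `ψ(Z) = i tr(γ Z) + ∫ (exp(i tr(X Z)) - 1) κ(dX)`, the integral over the positive semidefinite
matrices. -/
def charExponent {d : ℕ} (γ : Matrix (Fin d) (Fin d) ℝ)
    (κ : Measure (Matrix (Fin d) (Fin d) ℝ)) (Z : Matrix (Fin d) (Fin d) ℂ) : ℂ :=
  Complex.I * (toComplexMatrix γ * Z).trace +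
    ∫ X in {X : Matrix (Fin d) (Fin d) ℝ | X.PosSemidef},
      (Complex.exp (Complex.I * (toComplexMatrix X * Z).trace) - 1) ∂κ

/-- The integrand `exp(tr(X Z)) - 1` of the cumulant transform. -/
def cumulantIntegrand {d : ℕ} (Z : Matrix (Fin d) (Fin d) ℂ) (X : Matrix (Fin d) (Fin d) ℝ) : ℂ :=
  Complex.exp (toComplexMatrix X * Z).trace - 1

/-- `Θ(Z) = tr(γ Z) + ∫ (exp(tr(X Z)) - 1) κ(dX)`, the integral over the positive semidefinite
matrices; meaningful for those `Z` at which the integrand is integrable. -/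
def cumulantTransform {d : ℕ} (γ : Matrix (Fin d) (Fin d) ℝ)
    (κ : Measure (Matrix (Fin d) (Fin d) ℝ)) (Z : Matrix (Fin d) (Fin d) ℂ) : ℂ :=
  (toComplexMatrix γ * Z).trace +
    ∫ X in {X : Matrix (Fin d) (Fin d) ℝ | X.PosSemidef}, cumulantIntegrand Z X ∂κ

theorem cumulantTransform_eq_charExponent {d : ℕ} (γ : Matrix (Fin d) (Fin d) ℝ)
    (κ : Measure (Matrix (Fin d) (Fin d) ℝ)) (Z : Matrix (Fin d) (Fin d) ℂ) :
    cumulantTransform γ κ Z = charExponent γ κ (-Complex.I • Z) := by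
  have h : ∀ a : ℂ, Complex.I * (-Complex.I * a) = a := fun a => by
    rw [← mul_assoc, mul_neg, Complex.I_mul_I, neg_neg, one_mul]
  simp only [cumulantTransform, charExponent, cumulantIntegrand, Matrix.mul_smul,
    Matrix.trace_smul, smul_eq_mul, h]

/-- `γ` and `κ` are the drift and the Lévy measure of the matrix subordinator `L`: `γ` is positive
semidefinite, `κ` is a Lévy measure concentrated on the positive semidefinite matrices with
`∫_{‖X‖ ≤ 1} ‖X‖ κ(dX) < ∞`, and `E exp(i tr(Z L₁)) = exp(ψ(Z))` for all real `Z`. Here `N` is the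
norm on real matrices. -/
structure HasDriftAndLevyMeasure {d : ℕ} {Ω : Type*} [MeasurableSpace Ω]
    (N : Seminorm ℝ (Matrix (Fin d) (Fin d) ℝ))
    (L : ℝ≥0 → Ω → Matrix (Fin d) (Fin d) ℝ) (P : Measure Ω)
    (γ : Matrix (Fin d) (Fin d) ℝ) (κ : Measure (Matrix (Fin d) (Fin d) ℝ)) : Prop where
  drift_posSemidef : γ.PosSemidef
  levy_zero : κ {0} = 0
  levy_sq : ∫⁻ X, ENNReal.ofReal (min 1 (N X ^ 2)) ∂κ < ∞
  levy_posSemidef : κ {X | ¬ X.PosSemidef} = 0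
  levy_small : ∫⁻ X in {X | N X ≤ 1}, ENNReal.ofReal (N X) ∂κ < ∞
  charFun_eq : ∀ Z : Matrix (Fin d) (Fin d) ℝ,
    ∫ ω, Complex.exp (Complex.I * (((Z * L 1 ω).trace : ℝ) : ℂ)) ∂P =
      Complex.exp (charExponent γ κ (toComplexMatrix Z))

/-- `S_ε = {Z : ‖Re Z‖ < ε} - {positive semidefinite real matrices}`, a Minkowski difference. -/
def stripMinusCone {d : ℕ} (N : Seminorm ℝ (Matrix (Fin d) (Fin d) ℝ)) (ε : ℝ) :
    Set (Matrix (Fin d) (Fin d) ℂ) :=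
  {Z | N (Z.map Complex.re) < ε} -
    toComplexMatrix '' {X : Matrix (Fin d) (Fin d) ℝ | X.PosSemidef}

/-- `∫_{‖X‖ ≥ 1} exp(tr(R X)) κ(dX) < ∞` for all real matrices `R` with `‖R‖ < ε`. -/
def FiniteExpMoments {d : ℕ} (N : Seminorm ℝ (Matrix (Fin d) (Fin d) ℝ))
    (κ : Measure (Matrix (Fin d) (Fin d) ℝ)) (ε : ℝ) : Prop :=
  ∀ R : Matrix (Fin d) (Fin d) ℝ, N R < ε →
    ∫⁻ X in {X | 1 ≤ N X}, ENNReal.ofReal (Real.exp (R * X).trace) ∂κ < ∞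

/-- `Θ` is defined by an absolutely convergent integral at each point of `S`, and is analytic
on `S`. -/
def CumulantAnalyticOn {d : ℕ} (γ : Matrix (Fin d) (Fin d) ℝ)
    (κ : Measure (Matrix (Fin d) (Fin d) ℝ)) (S : Set (Matrix (Fin d) (Fin d) ℂ)) : Prop :=
  (∀ Z ∈ S, IntegrableOn (cumulantIntegrand Z)
    {X : Matrix (Fin d) (Fin d) ℝ | X.PosSemidef} κ) ∧
  AnalyticOnNhd ℂ (cumulantTransform γ κ) S

/-- `Θ`, which is always defined on `i M_d(ℝ)`, has an analytic extension from there to `S`. -/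
def CumulantExtendsAnalyticallyTo {d : ℕ} (γ : Matrix (Fin d) (Fin d) ℝ)
    (κ : Measure (Matrix (Fin d) (Fin d) ℝ)) (S : Set (Matrix (Fin d) (Fin d) ℂ)) : Prop :=
  ∃ F : Matrix (Fin d) (Fin d) ℂ → ℂ, AnalyticOnNhd ℂ F S ∧
    ∀ Y : Matrix (Fin d) (Fin d) ℝ,
      F (Complex.I • toComplexMatrix Y) = cumulantTransform γ κ (Complex.I • toComplexMatrix Y)

end

/-
If the exponential moments are finite, each `Z` in `S_ε` has a `δ > 0` with `Z + δ 1` still in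
`S_ε`, and `tr X` bounds the norm of a positive semidefinite `X`. For the large jumps, the absolute
Taylor series at `Z` of the integrand `exp(tr(X Z)) - 1` is therefore dominated by a multiple of
`exp(tr(X (Z + δ 1)))`. Integrating term by term shows that `Θ` is analytic.

Conversely, the jumps with `‖X‖ < 1` contribute an entire function to `Θ`. Subtracting it from an
analytic extension of `Θ` leaves, on the line `{i t R}`, the characteristic function of the image
under `X ↦ tr(R X)` of the finite measure of the jumps with `‖X‖ ≥ 1`, up to an affine term. If
`‖R‖ < ε`, that characteristic function extends analytically to a disc of radius larger than `1`.
Its Taylor coefficients give the even moments, so its Taylor series, which converges absolutely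
at `1`, bounds the integral of `cosh(tr(R X))`.
-/

theorem hasFPowerSeriesOnBall_integral {𝕜 α E F : Type*} [RCLike 𝕜] [MeasurableSpace α]
    {μ : Measure α} [NormedAddCommGroup E] [NormedSpace 𝕜 E] [NormedAddCommGroup F]
    [NormedSpace 𝕜 F] [NormedSpace ℝ F] [CompleteSpace F] {f : α → E → F}
    {p : α → FormalMultilinearSeries 𝕜 E F} {z₀ : E} {r : ℝ≥0} {g : α → ℝ} (hr : 0 < r)
    (hp : ∀ n, AEStronglyMeasurable (fun x => p x n) μ)
    (hf : ∀ᵐ x ∂μ, HasFPowerSeriesOnBall (f x) (p x) z₀ r) (hg : Integrable g μ)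
    (hpg : ∀ᵐ x ∂μ, ∀ n, ∑ k ∈ Finset.range n, ‖p x k‖ * r ^ k ≤ g x) :
    HasFPowerSeriesOnBall (fun z => ∫ x, f x z ∂μ) (fun n => ∫ x, p x n ∂μ) z₀ r := by
  have hterm : ∀ n, ∀ᵐ x ∂μ, ‖p x n‖ * r ^ n ≤ g x := fun n => by
    filter_upwards [hpg] with x hx
    exact (Finset.single_le_sum (f := fun k => ‖p x k‖ * (r : ℝ) ^ k)
      (fun k _ => by positivity) (Finset.self_mem_range_succ n)).trans (hx (n + 1))
  have hint : ∀ n, Integrable (fun x => p x n) μ := fun n => by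
    refine (hg.div_const ((r : ℝ) ^ n)).mono' (hp n) ?_
    filter_upwards [hterm n] with x hx
    rwa [le_div_iff₀ (by positivity)]
  refine ⟨FormalMultilinearSeries.le_radius_of_bound _ (∫ x, g x ∂μ) fun n => ?_, by simpa,
    fun {y} hy => ?_⟩
  · calc ‖∫ x, p x n ∂μ‖ * (r : ℝ) ^ n ≤ (∫ x, ‖p x n‖ ∂μ) * r ^ n := by
          gcongr
          exact norm_integral_le_integral_norm _
      _ = ∫ x, ‖p x n‖ * r ^ n ∂μ := (integral_mul_const _ _).symm
      _ ≤ ∫ x, g x ∂μ := integral_mono_ae ((hint n).norm.mul_const _) hg (hterm n)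
  · let eval n := ContinuousMultilinearMap.apply 𝕜 (fun _ : Fin n => E) F fun _ => y
    have heval : ∀ n x, ‖eval n (p x n)‖ ≤ ‖p x n‖ * (r : ℝ) ^ n := fun n x =>
      (p x n).le_opNorm_mul_pow_of_le <| (pi_norm_le_iff_of_nonneg r.coe_nonneg).2 fun _ =>
        (mem_ball_zero_iff.1 (Metric.eball_coe (α := E) ▸ hy)).le
    have hsum := hasSum_integral_of_summable_integral_norm (μ := μ)
      (F := fun n x => eval n (p x n)) (fun n => (eval n).integrable_comp (hint n)) ?_
    · convert hsum using 1
      · exact funext fun n => ((eval n).integral_comp_comm (hint n)).symm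
      · refine integral_congr_ae ?_
        filter_upwards [hf] with x hx
        exact (hx.hasSum hy).tsum_eq.symm
    · refine summable_of_sum_range_le (c := ∫ x, g x ∂μ) (fun n => by positivity) fun n => ?_
      rw [← integral_finsetSum _ fun k _ => ((eval k).integrable_comp (hint k)).norm]
      refine integral_mono_ae
        (integrable_finsetSum _ fun k _ => ((eval k).integrable_comp (hint k)).norm) hg ?_
      filter_upwards [hpg] with x hx
      exact (Finset.sum_le_sum fun k _ => heval k x).trans (hx n)

section ExpIntegral

variable {E : Type*} [NormedAddCommGroup E] [NormedSpace ℂ E]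

/-- The Taylor series of `z ↦ exp (ℓ z) - 1` at `z₀`. -/
noncomputable def cexpSubOneSeries (z₀ : E) (ℓ : E →L[ℂ] ℂ) : FormalMultilinearSeries ℂ E ℂ :=
  Complex.exp (ℓ z₀) • (NormedSpace.expSeries ℂ ℂ).compContinuousLinearMap ℓ -
    constFormalMultilinearSeries ℂ E 1

theorem hasFPowerSeriesOnBall_cexpSubOneSeries (z₀ : E) (ℓ : E →L[ℂ] ℂ) :
    HasFPowerSeriesOnBall (fun z => Complex.exp (ℓ z) - 1) (cexpSubOneSeries z₀ ℓ) z₀ ⊤ := by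
  have hexp : HasFPowerSeriesOnBall (Complex.exp ∘ ℓ)
      ((NormedSpace.expSeries ℂ ℂ).compContinuousLinearMap ℓ) 0 ⊤ := by
    have h : HasFPowerSeriesOnBall NormedSpace.exp (NormedSpace.expSeries ℂ ℂ) (ℓ 0) ⊤ := by
      simpa only [map_zero] using NormedSpace.exp_hasFPowerSeriesOnBall (𝕂 := ℂ) (𝔸 := ℂ)
    simpa [Complex.exp_eq_exp_ℂ, ENNReal.top_div] using h.compContinuousLinearMap (u := ℓ)
  have hshift := (hexp.comp_sub z₀).const_smul (c := Complex.exp (ℓ z₀))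
  rw [zero_add] at hshift
  refine (hshift.congr fun z _ => ?_).sub hasFPowerSeriesOnBall_const
  simp [← Complex.exp_add]

theorem continuous_cexpSubOneSeries (z₀ : E) (n : ℕ) :
    Continuous fun ℓ : E →L[ℂ] ℂ => cexpSubOneSeries z₀ ℓ n := by
  have hcomp := (ContinuousMultilinearMap.compContinuousLinearMapContinuousMultilinear ℂ
    (fun _ : Fin n => E) (fun _ : Fin n => ℂ) ℂ).cont.comp (continuous_pi fun _ => continuous_id)
  have hexp : Continuous fun ℓ : E →L[ℂ] ℂ => Complex.exp (ℓ z₀) := by fun_prop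
  exact (hexp.smul (hcomp.clm_apply continuous_const)).sub continuous_const

theorem norm_cexpSubOneSeries_zero (z₀ : E) (ℓ : E →L[ℂ] ℂ) :
    ‖cexpSubOneSeries z₀ ℓ 0‖ = ‖Complex.exp (ℓ z₀) - 1‖ := by
  rw [← (hasFPowerSeriesOnBall_cexpSubOneSeries z₀ ℓ).coeff_zero 0]
  exact (ContinuousMultilinearMap.fin0_apply_norm _).symm

theorem norm_cexpSubOneSeries_succ_le (z₀ : E) (ℓ : E →L[ℂ] ℂ) (n : ℕ) :
    ‖cexpSubOneSeries z₀ ℓ (n + 1)‖ ≤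
      Real.exp (ℓ z₀).re * (‖ℓ‖ ^ (n + 1) / (n + 1).factorial) := by
  have hnorm : ‖NormedSpace.expSeries ℂ ℂ (n + 1)‖ = ((n + 1).factorial : ℝ)⁻¹ := by
    simp [NormedSpace.expSeries, norm_smul]
  have hcoeff : cexpSubOneSeries z₀ ℓ (n + 1) =
      Complex.exp (ℓ z₀) • (NormedSpace.expSeries ℂ ℂ).compContinuousLinearMap ℓ (n + 1) :=
    sub_zero _
  rw [hcoeff, norm_smul, Complex.norm_exp, div_eq_inv_mul, ← hnorm]
  gcongr
  exact (NormedSpace.expSeries ℂ ℂ).norm_compContinuousLinearMap_le ℓ (n + 1)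

theorem sum_range_norm_cexpSubOneSeries_mul_pow_le (z₀ : E) (ℓ : E →L[ℂ] ℂ) {r : ℝ} (hr : 0 ≤ r)
    (n : ℕ) :
    ∑ k ∈ Finset.range n, ‖cexpSubOneSeries z₀ ℓ k‖ * r ^ k ≤
      ‖Complex.exp (ℓ z₀) - 1‖ + Real.exp (ℓ z₀).re * (Real.exp (r * ‖ℓ‖) - 1) := by
  have hexp := Real.sum_le_exp_of_nonneg (mul_nonneg hr (norm_nonneg ℓ)) (n + 1)
  rw [Finset.sum_range_succ', pow_zero, Nat.factorial_zero, Nat.cast_one, div_one] at hexp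
  calc ∑ k ∈ Finset.range n, ‖cexpSubOneSeries z₀ ℓ k‖ * r ^ k
      ≤ ∑ k ∈ Finset.range (n + 1), ‖cexpSubOneSeries z₀ ℓ k‖ * r ^ k :=
        Finset.sum_le_sum_of_subset_of_nonneg (Finset.range_mono n.le_succ)
          fun k _ _ => by positivity
    _ = ‖Complex.exp (ℓ z₀) - 1‖ +
          ∑ k ∈ Finset.range n, ‖cexpSubOneSeries z₀ ℓ (k + 1)‖ * r ^ (k + 1) := by
        rw [Finset.sum_range_succ', norm_cexpSubOneSeries_zero, pow_zero, mul_one, add_comm]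
    _ ≤ ‖Complex.exp (ℓ z₀) - 1‖ + ∑ k ∈ Finset.range n,
          Real.exp (ℓ z₀).re * ((r * ‖ℓ‖) ^ (k + 1) / (k + 1).factorial) := by
        gcongr _ + ∑ k ∈ _, ?_ with k
        exact (mul_le_mul_of_nonneg_right (norm_cexpSubOneSeries_succ_le z₀ ℓ k)
          (by positivity)).trans_eq (by ring)
    _ ≤ _ := by
        rw [← Finset.mul_sum]
        gcongr
        linarith

theorem norm_cexp_sub_one_le (w : ℂ) :
    ‖Complex.exp w - 1‖ ≤ min 1 ‖w‖ * (1 + Real.exp w.re) := by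
  have hexp := Real.exp_pos w.re
  rw [min_mul_of_nonneg _ _ (by positivity), le_min_iff]
  constructor
  · simpa [Complex.norm_exp, add_comm] using norm_sub_le (Complex.exp w) 1
  · have hderiv : ∀ z ∈ {z : ℂ | z.re ≤ max 0 w.re}, ‖Complex.exp z‖ ≤ 1 + Real.exp w.re := by
      intro z hz
      rw [Complex.norm_exp]
      refine (Real.exp_le_exp.2 hz).trans ?_
      rw [Real.exp_monotone.map_max, Real.exp_zero]
      exact max_le (by linarith) (by linarith)
    have hmvt := (convex_halfSpace_re_le (max 0 w.re)).norm_image_sub_le_of_norm_hasDerivWithin_le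
      (fun z _ => (Complex.hasDerivAt_exp z).hasDerivWithinAt) hderiv
      (Set.mem_ofPred.2 (le_max_left 0 w.re) : (0 : ℂ) ∈ _)
      (Set.mem_ofPred.2 (le_max_right 0 w.re))
    rwa [Complex.exp_zero, sub_zero, mul_comm] at hmvt

theorem norm_cexp_apply_sub_one_le (ℓ : E →L[ℂ] ℂ) (z : E) :
    ‖Complex.exp (ℓ z) - 1‖ ≤ max 1 ‖z‖ * (min 1 ‖ℓ‖ + min 1 ‖ℓ‖ * Real.exp (ℓ z).re) := by
  have hmin : min 1 ‖ℓ z‖ ≤ max 1 ‖z‖ * min 1 ‖ℓ‖ := by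
    rw [mul_min_of_nonneg _ _ (by positivity), mul_one]
    refine min_le_min (le_max_left _ _) ((ℓ.le_opNorm z).trans ?_)
    rw [mul_comm]
    gcongr
    exact le_max_right _ _
  calc _ ≤ min 1 ‖ℓ z‖ * (1 + Real.exp (ℓ z).re) := norm_cexp_sub_one_le _
    _ ≤ max 1 ‖z‖ * min 1 ‖ℓ‖ * (1 + Real.exp (ℓ z).re) := by gcongr
    _ = _ := by ring

theorem exp_mul_sub_one_le (c : ℝ) {t : ℝ} (ht : 0 ≤ t) :
    Real.exp (c * t) - 1 ≤ max 1 c * (min 1 t * Real.exp (c * t)) := by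
  rw [min_mul_of_nonneg _ _ (Real.exp_nonneg _), mul_min_of_nonneg _ _ (by positivity), one_mul,
    le_min_iff]
  have hexp := Real.exp_pos (c * t)
  have hexp_neg : 1 - c * t ≤ Real.exp (-(c * t)) := Real.one_sub_le_exp_neg _
  have hcancel : Real.exp (-(c * t)) * Real.exp (c * t) = 1 := by simp [← Real.exp_add]
  constructor
  · nlinarith [le_max_left 1 c]
  · calc Real.exp (c * t) - 1 ≤ c * (t * Real.exp (c * t)) := by nlinarith
      _ ≤ max 1 c * (t * Real.exp (c * t)) := by
        gcongr
        exact le_max_right _ _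

variable {α : Type*} [MeasurableSpace α] {μ : Measure α} {ℓ : α → E →L[ℂ] ℂ}

theorem integrable_cexp_sub_one (hℓ : AEStronglyMeasurable ℓ μ)
    (hmin : Integrable (fun x => min 1 ‖ℓ x‖) μ) {z : E}
    (hexp : Integrable (fun x => min 1 ‖ℓ x‖ * Real.exp (ℓ x z).re) μ) :
    Integrable (fun x => Complex.exp (ℓ x z) - 1) μ := by
  have hcont : Continuous fun l : E →L[ℂ] ℂ => Complex.exp (l z) - 1 := by fun_prop
  exact ((hmin.add hexp).const_mul (max 1 ‖z‖)).mono' (hcont.comp_aestronglyMeasurable hℓ)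
    (ae_of_all _ fun x => norm_cexp_apply_sub_one_le (ℓ x) z)

theorem integrable_min_one_mul_exp_re (hℓ : AEStronglyMeasurable ℓ μ) {z : E} {c : ℝ}
    (hc : 0 ≤ c)
    (hexp : Integrable (fun x => min 1 ‖ℓ x‖ * Real.exp ((ℓ x z).re + c * ‖ℓ x‖)) μ) :
    Integrable (fun x => min 1 ‖ℓ x‖ * Real.exp (ℓ x z).re) μ := by
  have hcont : Continuous fun l : E →L[ℂ] ℂ => min 1 ‖l‖ * Real.exp (l z).re := by fun_prop
  refine hexp.mono' (hcont.comp_aestronglyMeasurable hℓ) (ae_of_all _ fun x => ?_)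
  rw [Real.norm_of_nonneg (by positivity)]
  gcongr
  exact le_add_of_nonneg_right (by positivity)

theorem analyticAt_integral_cexp_sub_one (hℓ : AEStronglyMeasurable ℓ μ)
    (hmin : Integrable (fun x => min 1 ‖ℓ x‖) μ) {z₀ : E} {c : ℝ} (hc : 0 < c)
    (hexp : Integrable (fun x => min 1 ‖ℓ x‖ * Real.exp ((ℓ x z₀).re + c * ‖ℓ x‖)) μ) :
    AnalyticAt ℂ (fun z => ∫ x, (Complex.exp (ℓ x z) - 1) ∂μ) z₀ := by
  have hcont : Continuous fun l : E →L[ℂ] ℂ =>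
      Real.exp (l z₀).re * (Real.exp (c * ‖l‖) - 1) := by fun_prop
  have hint : Integrable (fun x => Complex.exp (ℓ x z₀) - 1) μ :=
    integrable_cexp_sub_one hℓ hmin (integrable_min_one_mul_exp_re hℓ hc.le hexp)
  have hint' : Integrable
      (fun x => Real.exp (ℓ x z₀).re * (Real.exp (c * ‖ℓ x‖) - 1)) μ := by
    refine (hexp.const_mul (max 1 c)).mono' (hcont.comp_aestronglyMeasurable hℓ)
      (ae_of_all _ fun x => ?_)
    have hnonneg : 0 ≤ Real.exp (c * ‖ℓ x‖) - 1 := sub_nonneg.2 (Real.one_le_exp (by positivity))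
    rw [Real.norm_of_nonneg (by positivity), Real.exp_add]
    calc _ ≤ Real.exp (ℓ x z₀).re * (max 1 c * (min 1 ‖ℓ x‖ * Real.exp (c * ‖ℓ x‖))) := by
          gcongr
          exact exp_mul_sub_one_le c (norm_nonneg _)
      _ = _ := by ring
  exact (hasFPowerSeriesOnBall_integral (r := ⟨c, hc.le⟩) hc
    (fun n => (continuous_cexpSubOneSeries z₀ n).comp_aestronglyMeasurable hℓ)
    (ae_of_all _ fun x => (hasFPowerSeriesOnBall_cexpSubOneSeries z₀ (ℓ x)).mono
      (ENNReal.coe_pos.2 hc) le_top)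
    (hint.norm.add hint')
    (ae_of_all _ fun x => sum_range_norm_cexpSubOneSeries_mul_pow_le z₀ (ℓ x) hc.le)).analyticAt

theorem integrable_min_one_mul_exp_of_ae_norm_le (hℓ : AEStronglyMeasurable ℓ μ)
    (hmin : Integrable (fun x => min 1 ‖ℓ x‖) μ) {C : ℝ} (hC : ∀ᵐ x ∂μ, ‖ℓ x‖ ≤ C) (z : E) {c : ℝ}
    (hc : 0 ≤ c) :
    Integrable (fun x => min 1 ‖ℓ x‖ * Real.exp ((ℓ x z).re + c * ‖ℓ x‖)) μ := by
  have hcont : Continuous fun l : E →L[ℂ] ℂ =>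
      min 1 ‖l‖ * Real.exp ((l z).re + c * ‖l‖) := by fun_prop
  refine (hmin.mul_const (Real.exp (C * ‖z‖ + c * C))).mono'
    (hcont.comp_aestronglyMeasurable hℓ) ?_
  filter_upwards [hC] with x hx
  rw [Real.norm_of_nonneg (by positivity)]
  gcongr
  exact (Complex.re_le_norm _).trans ((ℓ x).le_of_opNorm_le hx z)

end ExpIntegral

section CharFun

theorem isBigO_second_difference {E : Type*} [NormedAddCommGroup E] [NormedSpace ℝ E] {f : ℝ → E}
    {x : ℝ} (hf : ContDiffAt ℝ 2 f x) :
    (fun t => (2 : ℝ) • f x - f (x + t) - f (x - t)) =O[𝓝 0] fun t => t ^ 2 := by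
  obtain ⟨δ, hδ, hball⟩ := Metric.eventually_nhds_iff_ball.1 (hf.eventually (by simp))
  have htaylor := taylor_isLittleO (n := 2) (convex_ball x δ) (Metric.mem_ball_self hδ)
    fun y hy => (hball y hy).contDiffWithinAt
  rw [Metric.isOpen_ball.nhdsWithin_eq (Metric.mem_ball_self hδ)] at htaylor
  have hadd : Tendsto (fun t => x + t) (𝓝 0) (𝓝 x) := by
    simpa using (continuous_const_add x).tendsto 0
  have hsub : Tendsto (fun t => x - t) (𝓝 0) (𝓝 x) := by
    simpa using (continuous_sub_left x).tendsto 0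
  have hadd' := (htaylor.comp_tendsto hadd).isBigO.congr_right (g₂ := fun t => t ^ 2)
    fun t => by simp
  have hsub' := (htaylor.comp_tendsto hsub).isBigO.congr_right (g₂ := fun t => t ^ 2)
    fun t => by simp
  have hquad : (fun t : ℝ => t ^ 2 • iteratedDerivWithin 2 f (Metric.ball x δ) x)
      =O[𝓝 0] fun t => t ^ 2 :=
    Asymptotics.IsBigO.of_bound ‖iteratedDerivWithin 2 f (Metric.ball x δ) x‖
      (Eventually.of_forall fun t => by rw [norm_smul, mul_comm])
  have hpoly : ∀ t, taylorWithinEval f 2 (Metric.ball x δ) x (x + t) =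
      f x + t • iteratedDerivWithin 1 f (Metric.ball x δ) x +
        (t ^ 2 / 2) • iteratedDerivWithin 2 f (Metric.ball x δ) x := fun t => by
    norm_num [taylorWithinEval_succ, div_eq_inv_mul]
  refine (((hadd'.add hsub').add hquad).neg_left).congr_left fun t => ?_
  simp only [Function.comp_apply, sub_eq_add_neg x t, hpoly]
  module

theorem integrable_two_mul_one_sub_cos (μ : Measure ℝ) [IsFiniteMeasure μ] (t : ℝ) :
    Integrable (fun x => 2 * (1 - Real.cos (t * x))) μ := by
  refine (integrable_const (4 : ℝ)).mono' (by fun_prop) (ae_of_all _ fun x => ?_)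
  rw [Real.norm_eq_abs, abs_le]
  constructor <;> linarith [Real.cos_le_one (t * x), Real.neg_one_le_cos (t * x)]

theorem integrable_cexp_ofReal_mul_I {α : Type*} [MeasurableSpace α] {μ : Measure α}
    [IsFiniteMeasure μ] {f : α → ℝ} (hf : AEStronglyMeasurable f μ) :
    Integrable (fun x => Complex.exp (f x * Complex.I)) μ := by
  have hcont : Continuous fun y : ℝ => Complex.exp (y * Complex.I) := by fun_prop
  exact (integrable_const (1 : ℝ)).mono' (hcont.comp_aestronglyMeasurable hf)
    (ae_of_all _ fun x => (Complex.norm_exp_ofReal_mul_I _).le)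

theorem charFun_second_difference (μ : Measure ℝ) [IsFiniteMeasure μ] (t : ℝ) :
    (2 : ℝ) • charFun μ 0 - charFun μ t - charFun μ (-t) =
      ((∫ x, 2 * (1 - Real.cos (t * x)) ∂μ : ℝ) : ℂ) := by
  have hint : ∀ s : ℝ, Integrable (fun x : ℝ => Complex.exp (s * x * Complex.I)) μ := fun s => by
    simpa only [Complex.ofReal_mul] using
      integrable_cexp_ofReal_mul_I (μ := μ) (f := fun x => s * x) (by fun_prop)
  have hint₀ : Integrable (fun x : ℝ => (2 : ℝ) • Complex.exp ((0 : ℝ) * x * Complex.I)) μ :=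
    (hint 0).smul (2 : ℝ)
  have hsub : Integrable (fun x : ℝ => (2 : ℝ) • Complex.exp ((0 : ℝ) * x * Complex.I) -
      Complex.exp (t * x * Complex.I)) μ := hint₀.sub (hint t)
  simp only [charFun_apply_real]
  rw [← integral_smul, ← integral_sub hint₀ (hint t), ← integral_sub hsub (hint (-t)),
    ← integral_complex_ofReal]
  refine integral_congr_ae (ae_of_all _ fun x => ?_)
  simp only [Complex.ofReal_zero, zero_mul, Complex.exp_zero, Complex.real_smul, Complex.ofReal_neg,
    Complex.ofReal_mul, Complex.ofReal_sub, Complex.ofReal_one, Complex.ofReal_ofNat,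
    Complex.ofReal_cos, Complex.cos, neg_mul]
  ring

theorem tendsto_two_mul_one_sub_cos_div_sq (x : ℝ) :
    Tendsto (fun t : ℝ => 2 * (1 - Real.cos (t * x)) / t ^ 2) (𝓝[≠] 0) (𝓝 (x ^ 2)) := by
  have hsinc : Tendsto (fun t : ℝ => x ^ 2 * Real.sinc (t * x / 2) ^ 2) (𝓝 0) (𝓝 (x ^ 2)) := by
    have hcont : Continuous fun t : ℝ => x ^ 2 * Real.sinc (t * x / 2) ^ 2 := by fun_prop
    simpa using hcont.tendsto 0
  refine (hsinc.mono_left nhdsWithin_le_nhds).congr' ?_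
  filter_upwards [eventually_mem_nhdsWithin] with t (ht : t ≠ 0)
  rcases eq_or_ne x 0 with rfl | hx
  · simp
  have hcos : Real.cos (t * x) = 1 - 2 * Real.sin (t * x / 2) ^ 2 := by
    rw [← Real.cos_two_mul_eq_one_sub]
    ring_nf
  rw [Real.sinc_of_ne_zero (by positivity), hcos]
  field_simp
  ring

-- Fatou's lemma as `t → 0`, since `2 (1 - cos (t x)) / t ^ 2` tends to `x ^ 2`.
theorem integrable_sq_of_isBigO_second_difference_charFun {μ : Measure ℝ} [IsFiniteMeasure μ]
    (h : (fun t => (2 : ℝ) • charFun μ 0 - charFun μ t - charFun μ (-t))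
      =O[𝓝 0] fun t => t ^ 2) :
    Integrable (fun x => x ^ 2) μ := by
  obtain ⟨C, hC⟩ := h.bound
  have hbound : ∀ᶠ t : ℝ in 𝓝[≠] 0,
      ∫⁻ x, ENNReal.ofReal (2 * (1 - Real.cos (t * x)) / t ^ 2) ∂μ ≤ ENNReal.ofReal C := by
    filter_upwards [nhdsWithin_le_nhds hC, eventually_mem_nhdsWithin] with t htC (ht : t ≠ 0)
    have ht2 : 0 < t ^ 2 := by positivity
    rw [charFun_second_difference, Complex.norm_real, Real.norm_of_nonneg ht2.le] at htC
    rw [← ofReal_integral_eq_lintegral_ofReal ((integrable_two_mul_one_sub_cos μ t).div_const _)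
      (ae_of_all _ fun x => div_nonneg (by linarith [Real.cos_le_one (t * x)]) ht2.le),
      integral_div]
    exact ENNReal.ofReal_le_ofReal ((div_le_iff₀ ht2).2 ((le_abs_self _).trans htC))
  have hliminf : ∀ x : ℝ,
      liminf (fun t : ℝ => ENNReal.ofReal (2 * (1 - Real.cos (t * x)) / t ^ 2)) (𝓝[≠] 0) =
        ENNReal.ofReal (x ^ 2) := fun x =>
    (ENNReal.tendsto_ofReal (tendsto_two_mul_one_sub_cos_div_sq x)).liminf_eq
  refine ⟨by fun_prop, ?_⟩
  rw [hasFiniteIntegral_iff_ofReal (ae_of_all _ fun x => sq_nonneg x)]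
  simp only [← hliminf]
  refine (lintegral_liminf_le fun t => by fun_prop).trans_lt ?_
  exact (liminf_le_of_frequently_le' hbound.frequently).trans_lt ENNReal.ofReal_lt_top

theorem charFun_withDensity_sq {μ : Measure ℝ} [IsFiniteMeasure μ]
    (hμ : Integrable (fun x => x ^ 2) μ) (t : ℝ) :
    charFun (μ.withDensity fun x => ENNReal.ofReal (x ^ 2)) t = -iteratedDeriv 2 (charFun μ) t := by
  have hmem : MemLp id (2 : ℕ) μ := by
    simpa using (memLp_two_iff_integrable_sq (f := (id : ℝ → ℝ)) (by fun_prop)).2 hμ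
  rw [iteratedDeriv_charFun hmem, Complex.I_sq, neg_one_mul, neg_neg, charFun_apply_real,
    integral_withDensity_eq_integral_toReal_smul (by fun_prop)
      (ae_of_all _ fun _ => ENNReal.ofReal_lt_top)]
  refine integral_congr_ae (ae_of_all _ fun x => ?_)
  simp [ENNReal.toReal_ofReal (sq_nonneg x)]

theorem contDiffAt_iteratedDeriv {𝕜 F : Type*} [NontriviallyNormedField 𝕜] [NormedAddCommGroup F]
    [NormedSpace 𝕜 F] {f : 𝕜 → F} {x : 𝕜} {n : WithTop ℕ∞} {i : ℕ} {m : WithTop ℕ∞}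
    (hf : ContDiffAt 𝕜 n f x) (hmn : m + i ≤ n) : ContDiffAt 𝕜 m (iteratedDeriv i f) x :=
  (ContinuousMultilinearMap.apply 𝕜 (fun _ : Fin i => 𝕜) F fun _ => 1).contDiff.contDiffAt.comp x
    (hf.iteratedFDeriv_right hmn)

theorem integrable_pow_of_contDiffAt_charFun (k : ℕ) {μ : Measure ℝ} [IsFiniteMeasure μ]
    (hμ : ContDiffAt ℝ (2 * k : ℕ) (charFun μ) 0) : Integrable (fun x => x ^ (2 * k)) μ := by
  induction k generalizing μ with
  | zero => simp
  | succ k ih =>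
    have hsq : Integrable (fun x => x ^ 2) μ := by
      refine integrable_sq_of_isBigO_second_difference_charFun ?_
      simpa using isBigO_second_difference (hμ.of_le (by norm_cast; omega))
    have : IsFiniteMeasure (μ.withDensity fun x => ENNReal.ofReal (x ^ 2)) :=
      isFiniteMeasure_withDensity_ofReal hsq.2
    have hν := ih (μ := μ.withDensity fun x => ENNReal.ofReal (x ^ 2)) (by
      rw [funext (charFun_withDensity_sq hsq)]
      exact (contDiffAt_iteratedDeriv hμ (by norm_cast)).neg)
    rw [integrable_withDensity_iff_integrable_smul' (by fun_prop)
      (ae_of_all _ fun _ => ENNReal.ofReal_lt_top)] at hν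
    refine hν.congr (ae_of_all _ fun x => ?_)
    simp only [ENNReal.toReal_ofReal (sq_nonneg x), smul_eq_mul, ← pow_add]
    ring_nf

theorem norm_iteratedDeriv_charFun_zero {μ : Measure ℝ} [IsFiniteMeasure μ] (k : ℕ)
    (hμ : Integrable (fun x => x ^ (2 * k)) μ) :
    ‖iteratedDeriv (2 * k) (charFun μ) 0‖ = ∫ x, x ^ (2 * k) ∂μ := by
  have hnonneg : 0 ≤ ∫ x, x ^ (2 * k) ∂μ := integral_nonneg fun x => (even_two_mul k).pow_nonneg x
  have hmem : MemLp id (2 * k : ℕ) μ := by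
    rcases eq_or_ne k 0 with rfl | hk
    · simpa using (aestronglyMeasurable_id : AEStronglyMeasurable (id : ℝ → ℝ) μ)
    · rw [← integrable_norm_rpow_iff (by fun_prop) (by simpa) (ENNReal.natCast_ne_top _)]
      simpa [(even_two_mul k).pow_abs, ← Nat.cast_ofNat (R := ℝ), ← Nat.cast_mul] using hμ
  rw [iteratedDeriv_charFun_zero hmem, norm_mul, norm_pow, Complex.norm_I, one_pow, one_mul,
    Complex.norm_of_nonneg hnonneg]

theorem iteratedDeriv_comp_ofReal {G : ℂ → ℂ} {x : ℝ} (n : ℕ) (hG : AnalyticAt ℂ G x) :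
    iteratedDeriv n (fun t : ℝ => G t) x = iteratedDeriv n G x := by
  induction n generalizing G with
  | zero => simp
  | succ n ih =>
    rw [iteratedDeriv_succ', iteratedDeriv_succ', ← ih hG.deriv]
    refine EventuallyEq.iteratedDeriv_eq n ?_
    filter_upwards [Complex.continuous_ofReal.continuousAt.eventually hG.eventually_analyticAt]
      with t ht
    exact ht.differentiableAt.hasDerivAt.comp_ofReal.deriv

theorem integrable_pow_of_charFun_eventuallyEq {μ : Measure ℝ} [IsFiniteMeasure μ] {G : ℂ → ℂ}
    (hG : AnalyticAt ℂ G 0) (hμ : charFun μ =ᶠ[𝓝 0] fun t => G t) (k : ℕ) :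
    Integrable (fun x => x ^ (2 * k)) μ := by
  have hG' : AnalyticAt ℝ (fun t : ℝ => G t) 0 :=
    (Complex.ofReal_zero ▸ hG).restrictScalars.comp (Complex.ofRealCLM.analyticAt 0)
  exact integrable_pow_of_contDiffAt_charFun k (hG'.contDiffAt.congr_of_eventuallyEq hμ)

theorem integral_pow_of_charFun_eventuallyEq {μ : Measure ℝ} [IsFiniteMeasure μ] {G : ℂ → ℂ}
    (hG : AnalyticAt ℂ G 0) (hμ : charFun μ =ᶠ[𝓝 0] fun t => G t) (k : ℕ) :
    ∫ x, x ^ (2 * k) ∂μ = ‖iteratedDeriv (2 * k) G 0‖ := by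
  rw [← norm_iteratedDeriv_charFun_zero k (integrable_pow_of_charFun_eventuallyEq hG hμ k),
    hμ.iteratedDeriv_eq, iteratedDeriv_comp_ofReal _ (by simpa using hG), Complex.ofReal_zero]

theorem integrable_of_hasSum_of_summable_integral_norm {α ι E : Type*} [MeasurableSpace α]
    {μ : Measure α} [Countable ι] [NormedAddCommGroup E] {F : ι → α → E} {f : α → E}
    (hF : ∀ i, Integrable (F i) μ) (hsum : Summable fun i => ∫ x, ‖F i x‖ ∂μ)
    (hf : ∀ᵐ x ∂μ, HasSum (fun i => F i x) (f x)) : Integrable f μ := by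
  refine ⟨aestronglyMeasurable_of_tendsto_ae atTop
    (fun s : Finset ι => (integrable_finsetSum s fun i _ => hF i).1) hf, ?_⟩
  calc ∫⁻ x, ‖f x‖ₑ ∂μ ≤ ∫⁻ x, ∑' i, ‖F i x‖ₑ ∂μ := by
        refine lintegral_mono_ae ?_
        filter_upwards [hf] with x hx
        exact hx.tsum_eq ▸ enorm_tsum_le_tsum_enorm
    _ = ∑' i, ENNReal.ofReal (∫ x, ‖F i x‖ ∂μ) := by
        rw [lintegral_tsum fun i => (hF i).1.enorm]
        simp only [ofReal_integral_norm_eq_lintegral_enorm (hF _)]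
    _ < ∞ := hsum.tsum_ofReal_lt_top

theorem integrable_exp_mul_of_charFun_eventuallyEq {μ : Measure ℝ} [IsFiniteMeasure μ]
    {G : ℂ → ℂ} {a : ℝ} (hG : DifferentiableOn ℂ G (Metric.ball 0 a))
    (hμ : charFun μ =ᶠ[𝓝 0] fun t => G t) {r : ℝ} (hr : |r| < a) :
    Integrable (fun x => Real.exp (r * x)) μ := by
  have hG₀ : AnalyticAt ℂ G 0 :=
    hG.analyticAt (Metric.ball_mem_nhds 0 ((abs_nonneg r).trans_lt hr))
  have hmoment : ∀ k, Integrable (fun x => (r * x) ^ (2 * k) / (2 * k).factorial) μ := fun k => by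
    simpa only [mul_pow] using
      ((integrable_pow_of_charFun_eventuallyEq hG₀ hμ k).const_mul (r ^ (2 * k))).div_const _
  have htaylor : Summable fun n => ‖((n.factorial : ℂ)⁻¹ * (r : ℂ) ^ n) * iteratedDeriv n G 0‖ := by
    have hz : (r : ℂ) ∈ Metric.ball 0 a := by simpa using hr
    simpa [mul_assoc] using (Complex.hasSum_taylorSeries_on_ball hG hz).summable.norm
  have hnorm : ∀ k, ∫ x, ‖(r * x) ^ (2 * k) / (2 * k).factorial‖ ∂μ =
      ‖(((2 * k).factorial : ℂ)⁻¹ * (r : ℂ) ^ (2 * k)) * iteratedDeriv (2 * k) G 0‖ := fun k => by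
    have hpow : ∀ x, ‖(r * x) ^ (2 * k) / (2 * k).factorial‖ =
        |r| ^ (2 * k) / (2 * k).factorial * x ^ (2 * k) := fun x => by
      rw [norm_div, norm_pow, norm_mul, mul_pow, Real.norm_eq_abs, Real.norm_eq_abs,
        (even_two_mul k).pow_abs x, Real.norm_natCast]
      ring
    simp_rw [hpow, integral_const_mul, integral_pow_of_charFun_eventuallyEq hG₀ hμ k]
    simp [div_eq_inv_mul]
  have hcosh : Integrable (fun x => Real.cosh (r * x)) μ :=
    integrable_of_hasSum_of_summable_integral_norm hmoment
      (by simpa only [hnorm, Function.comp_def] using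
        htaylor.comp_injective (mul_right_injective₀ (two_ne_zero (α := ℕ))))
      (ae_of_all _ fun x => Real.hasSum_cosh (r * x))
  refine (hcosh.const_mul 2).mono' (by fun_prop) (ae_of_all _ fun x => ?_)
  rw [Real.norm_of_nonneg (Real.exp_nonneg _), Real.cosh_eq]
  linarith [Real.exp_pos (-(r * x))]

end CharFun

theorem continuous_seminorm {E : Type*} [NormedAddCommGroup E] [NormedSpace ℝ E]
    [FiniteDimensional ℝ E] (N : Seminorm ℝ E) : Continuous N :=
  N.convexOn.locallyLipschitz.continuous

theorem exists_norm_le_mul_seminorm {E : Type*} [NormedAddCommGroup E] [NormedSpace ℝ E]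
    [FiniteDimensional ℝ E] {N : Seminorm ℝ E} (hN : ∀ x, N x = 0 → x = 0) :
    ∃ C, ∀ x, ‖x‖ ≤ C * N x := by
  have hne : ∀ x ∈ Metric.sphere (0 : E) 1, N x ≠ 0 := fun x hx h =>
    ne_zero_of_mem_unit_sphere ⟨x, hx⟩ (hN x h)
  obtain ⟨C, hC⟩ := (isCompact_sphere (0 : E) 1).exists_bound_of_continuousOn
    ((continuous_seminorm N).continuousOn.inv₀ hne)
  refine ⟨C, fun x => ?_⟩
  rcases eq_or_ne x 0 with rfl | hx
  · simp
  have hpos : 0 < N x := (apply_nonneg N x).lt_of_ne' fun h => hx (hN x h)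
  have hunit : ‖x‖ / N x ≤ C := by
    simpa [map_smul_eq_mul, div_eq_mul_inv, mul_comm, abs_of_pos hpos] using
      hC (‖x‖⁻¹ • x) (by simp [norm_smul, hx])
  exact (div_le_iff₀ hpos).1 hunit

theorem exists_pos_norm_linearMap_le {E F : Type*} [NormedAddCommGroup E] [NormedSpace ℝ E]
    [FiniteDimensional ℝ E] [NormedAddCommGroup F] [NormedSpace ℝ F] (f : E →ₗ[ℝ] F) :
    ∃ C, 0 < C ∧ ∀ x, ‖f x‖ ≤ C * ‖x‖ :=
  (LinearMap.toContinuousLinearMap f).bound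

section PosSemidef

open scoped ComplexOrder MatrixOrder

variable {n 𝕜 : Type*} [Fintype n] [RCLike 𝕜] {X Y : Matrix n n 𝕜}

theorem exists_eq_conjTranspose_mul_self_of_posSemidef (hX : X.PosSemidef) :
    ∃ B : Matrix n n 𝕜, X = B.conjTranspose * B := by
  classical exact CStarAlgebra.nonneg_iff_eq_star_mul_self.1 hX.nonneg

theorem trace_mul_nonneg_of_posSemidef (hX : X.PosSemidef) (hY : Y.PosSemidef) :
    0 ≤ (X * Y).trace := by
  obtain ⟨B, rfl⟩ := exists_eq_conjTranspose_mul_self_of_posSemidef hX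
  rw [Matrix.mul_assoc, Matrix.trace_mul_comm]
  exact (hY.mul_mul_conjTranspose_same B).trace_nonneg

theorem frobenius_norm_le_re_trace_of_posSemidef (hX : X.PosSemidef) :
    ‖X‖ ≤ RCLike.re X.trace := by
  obtain ⟨B, rfl⟩ := exists_eq_conjTranspose_mul_self_of_posSemidef hX
  refine (Matrix.frobenius_norm_mul _ _).trans_eq ?_
  rw [Matrix.frobenius_norm_conjTranspose, Matrix.frobenius_norm_def, ← Real.sqrt_eq_rpow,
    Real.mul_self_sqrt (by positivity), Finset.sum_comm]
  simp [Matrix.trace, Matrix.mul_apply, RCLike.conj_mul]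

end PosSemidef

/-- The continuous dual of a complex normed space. Naming it makes matrices carry the topology of
the Frobenius norm here, so that the dual is normed; written out, the dual of the space of matrices
would be taken for the product topology. -/
abbrev NormedDual (E : Type*) [NormedAddCommGroup E] [NormedSpace ℂ E] : Type _ := E →L[ℂ] ℂ

section TracePairing

variable {d : ℕ}

theorem toComplexMatrix_add (X Y : Matrix (Fin d) (Fin d) ℝ) :
    toComplexMatrix (X + Y) = toComplexMatrix X + toComplexMatrix Y := by
  ext
  simp [toComplexMatrix]

theorem toComplexMatrix_smul (c : ℝ) (X : Matrix (Fin d) (Fin d) ℝ) :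
    toComplexMatrix (c • X) = c • toComplexMatrix X := by
  ext
  simp [toComplexMatrix]

theorem map_re_smul_toComplexMatrix (z : ℂ) (X : Matrix (Fin d) (Fin d) ℝ) :
    (z • toComplexMatrix X).map Complex.re = z.re • X := by
  ext
  simp [toComplexMatrix]

/-- The pairing `(X, Z) ↦ tr(X Z)` of real with complex matrices, as a linear map into the dual. -/
noncomputable def tracePairing (d : ℕ) :
    Matrix (Fin d) (Fin d) ℝ →ₗ[ℝ] NormedDual (Matrix (Fin d) (Fin d) ℂ) where
  toFun X := LinearMap.toContinuousLinearMap
    (Matrix.traceLinearMap (Fin d) ℂ ℂ ∘ₗ LinearMap.mulLeft ℂ (toComplexMatrix X))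
  map_add' X Y := by
    ext Z
    simp [toComplexMatrix_add, add_mul]
  map_smul' c X := by
    ext Z
    simp [toComplexMatrix_smul]

theorem tracePairing_apply (X : Matrix (Fin d) (Fin d) ℝ) (Z : Matrix (Fin d) (Fin d) ℂ) :
    tracePairing d X Z = (toComplexMatrix X * Z).trace := rfl

theorem continuous_tracePairing (d : ℕ) : Continuous (tracePairing d) :=
  LinearMap.continuous_of_finiteDimensional _

theorem re_tracePairing (X : Matrix (Fin d) (Fin d) ℝ) (Z : Matrix (Fin d) (Fin d) ℂ) :
    (tracePairing d X Z).re = (X * Z.map Complex.re).trace := by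
  simp [tracePairing_apply, Matrix.trace, Matrix.mul_apply, toComplexMatrix]

theorem tracePairing_smul_toComplexMatrix (X R : Matrix (Fin d) (Fin d) ℝ) (z : ℂ) :
    tracePairing d X (z • toComplexMatrix R) = z * ((R * X).trace : ℝ) := by
  rw [map_smul, smul_eq_mul, Matrix.trace_mul_comm]
  simp [tracePairing_apply, Matrix.trace, Matrix.mul_apply, toComplexMatrix]

theorem tracePairing_I_smul_toComplexMatrix (X Y : Matrix (Fin d) (Fin d) ℝ) :
    tracePairing d X (Complex.I • toComplexMatrix Y) = ((Y * X).trace : ℝ) * Complex.I := by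
  rw [tracePairing_smul_toComplexMatrix, mul_comm]

theorem exists_norm_tracePairing_le_mul_seminorm {N : Seminorm ℝ (Matrix (Fin d) (Fin d) ℝ)}
    (hN : ∀ X, N X = 0 → X = 0) : ∃ C, ∀ X, ‖tracePairing d X‖ ≤ C * N X := by
  obtain ⟨C₁, hC₁, hpair⟩ := exists_pos_norm_linearMap_le (tracePairing d)
  obtain ⟨C₂, hnorm⟩ := exists_norm_le_mul_seminorm hN
  refine ⟨C₁ * C₂, fun X => (hpair X).trans ?_⟩
  rw [mul_assoc]
  exact mul_le_mul_of_nonneg_left (hnorm X) hC₁.le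

theorem exists_norm_tracePairing_le_mul_trace (d : ℕ) :
    ∃ C, 0 < C ∧ ∀ X : Matrix (Fin d) (Fin d) ℝ, X.PosSemidef →
      ‖tracePairing d X‖ ≤ C * X.trace := by
  obtain ⟨C, hC, hpair⟩ := exists_pos_norm_linearMap_le (tracePairing d)
  exact ⟨C, hC, fun X hX => (hpair X).trans
    (mul_le_mul_of_nonneg_left (frobenius_norm_le_re_trace_of_posSemidef hX) hC.le)⟩

end TracePairing

section StripMinusCone

variable {d : ℕ} {N : Seminorm ℝ (Matrix (Fin d) (Fin d) ℝ)} {ε : ℝ}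

theorem isOpen_stripMinusCone (N : Seminorm ℝ (Matrix (Fin d) (Fin d) ℝ)) (ε : ℝ) :
    IsOpen (stripMinusCone N ε) :=
  IsOpen.sub_right <| isOpen_lt
    ((continuous_seminorm N).comp (continuous_id.matrix_map Complex.continuous_re))
    continuous_const

theorem convex_stripMinusCone (N : Seminorm ℝ (Matrix (Fin d) (Fin d) ℝ)) (ε : ℝ) :
    Convex ℝ (stripMinusCone N ε) := by
  refine Convex.sub ?_ ?_
  · have hball := (N.convex_ball 0 ε).linear_preimage (Complex.reLm.mapMatrix (m := Fin d))
    rw [Seminorm.ball_zero_eq] at hball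
    exact hball
  · rintro _ ⟨X, hX, rfl⟩ _ ⟨Y, hY, rfl⟩ a b ha hb -
    exact ⟨a • X + b • Y, (hX.smul ha).add (hY.smul hb), by
      simp only [toComplexMatrix_add, toComplexMatrix_smul]⟩

theorem exists_pos_add_smul_one_mem_stripMinusCone {Z : Matrix (Fin d) (Fin d) ℂ}
    (hZ : Z ∈ stripMinusCone N ε) :
    ∃ δ : ℝ, 0 < δ ∧ Z + (δ : ℂ) • 1 ∈ stripMinusCone N ε := by
  have hcont : Continuous fun δ : ℝ => Z + (δ : ℂ) • (1 : Matrix (Fin d) (Fin d) ℂ) := by fun_prop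
  have hmem : ∀ᶠ δ : ℝ in 𝓝[>] 0, Z + (δ : ℂ) • 1 ∈ stripMinusCone N ε :=
    nhdsWithin_le_nhds <| hcont.continuousAt.eventually_mem <|
      (isOpen_stripMinusCone N ε).mem_nhds (by simpa using hZ)
  exact (eventually_mem_nhdsWithin.and hmem).exists

theorem smul_toComplexMatrix_mem_stripMinusCone {z : ℂ} {R : Matrix (Fin d) (Fin d) ℝ}
    (h : |z.re| * N R < ε) : z • toComplexMatrix R ∈ stripMinusCone N ε := by
  refine ⟨z • toComplexMatrix R, ?_, 0, ⟨0, Matrix.PosSemidef.zero, by ext; simp [toComplexMatrix]⟩,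
    sub_zero _⟩
  rwa [Set.mem_ofPred_eq, map_re_smul_toComplexMatrix, map_smul_eq_mul, Real.norm_eq_abs]

theorem re_tracePairing_add_smul_one (X : Matrix (Fin d) (Fin d) ℝ)
    (Z : Matrix (Fin d) (Fin d) ℂ) (δ : ℝ) :
    (tracePairing d X (Z + (δ : ℂ) • 1)).re = (tracePairing d X Z).re + δ * X.trace := by
  have hone : (1 : Matrix (Fin d) (Fin d) ℂ) = toComplexMatrix 1 := by simp [toComplexMatrix]
  rw [map_add, Complex.add_re, hone, tracePairing_smul_toComplexMatrix, one_mul,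
    ← Complex.ofReal_mul, Complex.ofReal_re]

theorem re_tracePairing_sub_le {X P : Matrix (Fin d) (Fin d) ℝ} (hX : X.PosSemidef)
    (hP : P.PosSemidef) (W : Matrix (Fin d) (Fin d) ℂ) :
    (tracePairing d X (W - toComplexMatrix P)).re ≤ (W.map Complex.re * X).trace := by
  have hP_re := tracePairing_smul_toComplexMatrix X P 1
  rw [one_smul, one_mul] at hP_re
  rw [map_sub, Complex.sub_re, hP_re, Complex.ofReal_re, re_tracePairing, Matrix.trace_mul_comm X]
  exact sub_le_self _ (trace_mul_nonneg_of_posSemidef hP hX)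

end StripMinusCone

section JumpCumulant

variable {d : ℕ} {N : Seminorm ℝ (Matrix (Fin d) (Fin d) ℝ)} {γ : Matrix (Fin d) (Fin d) ℝ}
  {κ : Measure (Matrix (Fin d) (Fin d) ℝ)} {ε : ℝ}

theorem HasDriftAndLevyMeasure.integrable_min_one {Ω : Type*} [MeasurableSpace Ω]
    {L : ℝ≥0 → Ω → Matrix (Fin d) (Fin d) ℝ} {P : Measure Ω}
    (h : HasDriftAndLevyMeasure N L P γ κ) : Integrable (fun X => min 1 (N X)) κ := by
  have hN : Continuous N := continuous_seminorm N
  refine ⟨(continuous_const.min hN).aestronglyMeasurable, ?_⟩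
  rw [hasFiniteIntegral_iff_ofReal (ae_of_all _ fun X => by positivity)]
  calc ∫⁻ X, ENNReal.ofReal (min 1 (N X)) ∂κ
      ≤ ∫⁻ X, ENNReal.ofReal (min 1 (N X ^ 2)) +
          {X | N X ≤ 1}.indicator (fun X => ENNReal.ofReal (N X)) X ∂κ := by
        refine lintegral_mono fun X => ?_
        rcases le_or_gt (N X) 1 with hX | hX
        · simp [hX]
        · simp [hX.le, one_le_pow₀ hX.le]
    _ = ∫⁻ X, ENNReal.ofReal (min 1 (N X ^ 2)) ∂κ +
          ∫⁻ X in {X | N X ≤ 1}, ENNReal.ofReal (N X) ∂κ := by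
        rw [lintegral_add_left (by fun_prop),
          lintegral_indicator (measurableSet_le hN.measurable measurable_const)]
    _ < ∞ := ENNReal.add_lt_top.2 ⟨h.levy_sq, h.levy_small⟩

theorem measurableSet_one_le_seminorm (N : Seminorm ℝ (Matrix (Fin d) (Fin d) ℝ)) :
    MeasurableSet {X | 1 ≤ N X} := by
  have hN : Continuous N := continuous_seminorm N
  exact measurableSet_le measurable_const hN.measurable

theorem isFiniteMeasure_restrict_one_le_seminorm (hκ : Integrable (fun X => min 1 (N X)) κ) :
    IsFiniteMeasure (κ.restrict {X | 1 ≤ N X}) :=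
  isFiniteMeasure_restrict.2 (by simpa using (hκ.measure_ge_lt_top one_pos).ne)

theorem integrable_min_one_norm_tracePairing (hN : ∀ X, N X = 0 → X = 0)
    (hκ : Integrable (fun X => min 1 (N X)) κ) :
    Integrable (fun X => min 1 ‖tracePairing d X‖) κ := by
  obtain ⟨C, hC⟩ := exists_norm_tracePairing_le_mul_seminorm hN
  refine (hκ.const_mul (max 1 C)).mono'
    (continuous_const.min (continuous_tracePairing d).norm).aestronglyMeasurable
    (ae_of_all _ fun X => ?_)
  rw [Real.norm_of_nonneg (by positivity), mul_min_of_nonneg _ _ (by positivity), mul_one]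
  exact min_le_min (le_max_left _ _) ((hC X).trans
    (mul_le_mul_of_nonneg_right (le_max_right _ _) (apply_nonneg N X)))

theorem integrable_min_one_mul_exp_restrict_compl (hN : ∀ X, N X = 0 → X = 0)
    (hκ : Integrable (fun X => min 1 (N X)) κ) (Z : Matrix (Fin d) (Fin d) ℂ) {c : ℝ}
    (hc : 0 ≤ c) :
    Integrable (fun X => min 1 ‖tracePairing d X‖ *
      Real.exp ((tracePairing d X Z).re + c * ‖tracePairing d X‖))
      (κ.restrict {X | 1 ≤ N X}ᶜ) := by
  obtain ⟨C, hC⟩ := exists_norm_tracePairing_le_mul_seminorm hN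
  refine integrable_min_one_mul_exp_of_ae_norm_le (C := |C|)
    (continuous_tracePairing d).aestronglyMeasurable
    (integrable_min_one_norm_tracePairing hN hκ).restrict ?_ Z hc
  filter_upwards [ae_restrict_mem (measurableSet_one_le_seminorm N).compl] with X hX
  calc ‖tracePairing d X‖ ≤ C * N X := hC X
    _ ≤ |C| * N X := mul_le_mul_of_nonneg_right (le_abs_self C) (apply_nonneg N X)
    _ ≤ |C| := mul_le_of_le_one_right (abs_nonneg C) (not_le.1 (Set.notMem_ofPred_iff.1 hX)).le

theorem FiniteExpMoments.integrable_exp_re (hfin : FiniteExpMoments N κ ε)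
    (hpsd : ∀ᵐ X ∂κ, X.PosSemidef) {Z : Matrix (Fin d) (Fin d) ℂ}
    (hZ : Z ∈ stripMinusCone N ε) :
    Integrable (fun X => Real.exp (tracePairing d X Z).re) (κ.restrict {X | 1 ≤ N X}) := by
  obtain ⟨W, hW, _, ⟨P, hP, rfl⟩, rfl⟩ := hZ
  have hcont : Continuous fun l : NormedDual (Matrix (Fin d) (Fin d) ℂ) =>
      Real.exp (l (W - toComplexMatrix P)).re := by fun_prop
  refine ⟨(hcont.comp (continuous_tracePairing d)).aestronglyMeasurable, ?_⟩
  rw [hasFiniteIntegral_iff_ofReal (ae_of_all _ fun X => Real.exp_nonneg _)]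
  refine lt_of_le_of_lt (lintegral_mono_ae ?_) (hfin _ hW)
  filter_upwards [ae_restrict_of_ae hpsd] with X hX
  exact ENNReal.ofReal_le_ofReal (Real.exp_le_exp.2 (re_tracePairing_sub_le hX hP W))

theorem FiniteExpMoments.exists_integrable_min_one_mul_exp (hfin : FiniteExpMoments N κ ε)
    (hN : ∀ X, N X = 0 → X = 0) (hκ : Integrable (fun X => min 1 (N X)) κ)
    (hpsd : ∀ᵐ X ∂κ, X.PosSemidef) {Z : Matrix (Fin d) (Fin d) ℂ}
    (hZ : Z ∈ stripMinusCone N ε) :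
    ∃ c, 0 < c ∧ Integrable (fun X => min 1 ‖tracePairing d X‖ *
      Real.exp ((tracePairing d X Z).re + c * ‖tracePairing d X‖)) κ := by
  obtain ⟨δ, hδ, hZδ⟩ := exists_pos_add_smul_one_mem_stripMinusCone hZ
  obtain ⟨C, hC, htrace⟩ := exists_norm_tracePairing_le_mul_trace d
  have hcont : Continuous fun l : NormedDual (Matrix (Fin d) (Fin d) ℂ) =>
      min 1 ‖l‖ * Real.exp ((l Z).re + δ / C * ‖l‖) := by fun_prop
  have hbig : IntegrableOn (fun X => min 1 ‖tracePairing d X‖ *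
      Real.exp ((tracePairing d X Z).re + δ / C * ‖tracePairing d X‖)) {X | 1 ≤ N X} κ := by
    refine (hfin.integrable_exp_re hpsd hZδ).mono'
      (hcont.comp (continuous_tracePairing d)).aestronglyMeasurable ?_
    filter_upwards [ae_restrict_of_ae hpsd] with X hX
    have hle : δ / C * ‖tracePairing d X‖ ≤ δ * X.trace := by
      rw [div_mul_eq_mul_div, div_le_iff₀ hC, mul_assoc, mul_comm X.trace]
      exact mul_le_mul_of_nonneg_left (htrace X hX) hδ.le
    rw [Real.norm_of_nonneg (by positivity), re_tracePairing_add_smul_one]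
    refine (mul_le_of_le_one_left (Real.exp_nonneg _) (min_le_left _ _)).trans ?_
    gcongr
  have hc : 0 < δ / C := div_pos hδ hC
  refine ⟨δ / C, hc, ?_⟩
  rw [← integrableOn_univ, ← Set.union_compl_self {X | 1 ≤ N X}]
  exact hbig.union (integrable_min_one_mul_exp_restrict_compl hN hκ Z hc.le)

/-- The part of the cumulant transform due to the jumps, without the restriction of the integral to
the positive semidefinite matrices, so that `κ` can be split into its small and its large jumps. -/
noncomputable def jumpCumulant (κ : Measure (Matrix (Fin d) (Fin d) ℝ))
    (Z : Matrix (Fin d) (Fin d) ℂ) : ℂ :=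
  ∫ X, cumulantIntegrand Z X ∂κ

theorem cumulantTransform_eq_tracePairing_add_jumpCumulant (hpsd : ∀ᵐ X ∂κ, X.PosSemidef)
    (Z : Matrix (Fin d) (Fin d) ℂ) :
    cumulantTransform γ κ Z = tracePairing d γ Z + jumpCumulant κ Z := by
  have hrestrict : κ.restrict {X : Matrix (Fin d) (Fin d) ℝ | X.PosSemidef} = κ :=
    Measure.restrict_eq_self_of_ae_mem hpsd
  rw [cumulantTransform, hrestrict]
  rfl

theorem FiniteExpMoments.cumulantAnalyticOn (hfin : FiniteExpMoments N κ ε)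
    (hN : ∀ X, N X = 0 → X = 0) (hκ : Integrable (fun X => min 1 (N X)) κ)
    (hpsd : ∀ᵐ X ∂κ, X.PosSemidef) : CumulantAnalyticOn γ κ (stripMinusCone N ε) := by
  have hmeas := (continuous_tracePairing d).aestronglyMeasurable (μ := κ)
  have hmin := integrable_min_one_norm_tracePairing hN hκ
  refine ⟨fun Z hZ => ?_, fun Z hZ => ?_⟩ <;>
    obtain ⟨c, hc, hexp⟩ := hfin.exists_integrable_min_one_mul_exp hN hκ hpsd hZ
  · exact (integrable_cexp_sub_one hmeas hmin
      (integrable_min_one_mul_exp_re hmeas hc.le hexp)).integrableOn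
  · rw [funext (cumulantTransform_eq_tracePairing_add_jumpCumulant hpsd)]
    exact ((tracePairing d γ).analyticAt Z).add
      (analyticAt_integral_cexp_sub_one hmeas hmin hc hexp)

theorem analyticAt_jumpCumulant_restrict_compl (hN : ∀ X, N X = 0 → X = 0)
    (hκ : Integrable (fun X => min 1 (N X)) κ) (Z : Matrix (Fin d) (Fin d) ℂ) :
    AnalyticAt ℂ (jumpCumulant (κ.restrict {X | 1 ≤ N X}ᶜ)) Z :=
  analyticAt_integral_cexp_sub_one (continuous_tracePairing d).aestronglyMeasurable
    (integrable_min_one_norm_tracePairing hN hκ).restrict one_pos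
    (integrable_min_one_mul_exp_restrict_compl hN hκ Z zero_le_one)

theorem jumpCumulant_restrict_add_restrict_compl (hN : ∀ X, N X = 0 → X = 0)
    (hκ : Integrable (fun X => min 1 (N X)) κ) (Y : Matrix (Fin d) (Fin d) ℝ) :
    jumpCumulant (κ.restrict {X | 1 ≤ N X}) (Complex.I • toComplexMatrix Y) +
        jumpCumulant (κ.restrict {X | 1 ≤ N X}ᶜ) (Complex.I • toComplexMatrix Y) =
      jumpCumulant κ (Complex.I • toComplexMatrix Y) := by
  have hmin := integrable_min_one_norm_tracePairing hN hκ
  refine integral_add_compl (measurableSet_one_le_seminorm N) (integrable_cexp_sub_one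
    (continuous_tracePairing d).aestronglyMeasurable hmin ?_)
  simpa only [tracePairing_I_smul_toComplexMatrix, Complex.re_ofReal_mul, Complex.I_re, mul_zero,
    Real.exp_zero, mul_one] using hmin

theorem charFun_map_trace_mul (μ : Measure (Matrix (Fin d) (Fin d) ℝ)) [IsFiniteMeasure μ]
    (R : Matrix (Fin d) (Fin d) ℝ) (t : ℝ) :
    charFun (μ.map fun X => (R * X).trace) t =
      jumpCumulant μ (Complex.I • toComplexMatrix (t • R)) + μ.real Set.univ := by
  have htrace : Continuous fun X : Matrix (Fin d) (Fin d) ℝ => (R * X).trace := by fun_prop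
  have hint : Integrable (fun X => Complex.exp (((t • R) * X).trace * Complex.I)) μ :=
    integrable_cexp_ofReal_mul_I (f := fun X => ((t • R) * X).trace) <| by
      simpa using (htrace.const_mul t).aestronglyMeasurable
  have hjump : jumpCumulant μ (Complex.I • toComplexMatrix (t • R)) =
      ∫ X, (Complex.exp (((t • R) * X).trace * Complex.I) - 1) ∂μ := by
    simp only [jumpCumulant, cumulantIntegrand, ← tracePairing_apply,
      tracePairing_I_smul_toComplexMatrix]
  rw [hjump, integral_sub hint (integrable_const 1), charFun_apply_real,
    integral_map htrace.measurable.aemeasurable (by fun_prop)]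
  simp

theorem CumulantExtendsAnalyticallyTo.exists_analyticOnNhd_eq_charFun
    (hext : CumulantExtendsAnalyticallyTo γ κ (stripMinusCone N ε))
    (hN : ∀ X, N X = 0 → X = 0) (hκ : Integrable (fun X => min 1 (N X)) κ)
    (hpsd : ∀ᵐ X ∂κ, X.PosSemidef) :
    ∃ H : Matrix (Fin d) (Fin d) ℂ → ℂ, AnalyticOnNhd ℂ H (stripMinusCone N ε) ∧
      ∀ (R : Matrix (Fin d) (Fin d) ℝ) (t : ℝ),
        charFun ((κ.restrict {X | 1 ≤ N X}).map fun X => (R * X).trace) t =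
          H (Complex.I • toComplexMatrix (t • R)) := by
  obtain ⟨F, hF, hF_eq⟩ := hext
  have := isFiniteMeasure_restrict_one_le_seminorm hκ
  refine ⟨fun Z => F Z - tracePairing d γ Z - jumpCumulant (κ.restrict {X | 1 ≤ N X}ᶜ) Z +
    (κ.restrict {X | 1 ≤ N X}).real Set.univ, fun Z hZ => ?_, fun R t => ?_⟩
  · exact (((hF Z hZ).sub ((tracePairing d γ).analyticAt Z)).sub
      (analyticAt_jumpCumulant_restrict_compl hN hκ Z)).add analyticAt_const
  · beta_reduce
    rw [hF_eq, cumulantTransform_eq_tracePairing_add_jumpCumulant hpsd,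
      ← jumpCumulant_restrict_add_restrict_compl hN hκ, charFun_map_trace_mul]
    ring

theorem CumulantExtendsAnalyticallyTo.finiteExpMoments
    (hext : CumulantExtendsAnalyticallyTo γ κ (stripMinusCone N ε))
    (hN : ∀ X, N X = 0 → X = 0) (hκ : Integrable (fun X => min 1 (N X)) κ)
    (hpsd : ∀ᵐ X ∂κ, X.PosSemidef) : FiniteExpMoments N κ ε := by
  intro R hR
  obtain ⟨H, hH, hchar⟩ := hext.exists_analyticOnNhd_eq_charFun hN hκ hpsd
  have := isFiniteMeasure_restrict_one_le_seminorm hκ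
  obtain ⟨a, ha, haR⟩ : ∃ a : ℝ, 1 < a ∧ a * N R < ε := by
    have hlt : ∀ᶠ a : ℝ in 𝓝[>] 1, a * N R < ε := nhdsWithin_le_nhds <|
      (continuous_mul_const (N R)).continuousAt.eventually_lt_const (by simpa using hR)
    exact (eventually_mem_nhdsWithin.and hlt).exists
  have hG : DifferentiableOn ℂ (fun z => H ((z * Complex.I) • toComplexMatrix R))
      (Metric.ball 0 a) := by
    refine hH.differentiableOn.comp (by fun_prop) fun z hz => ?_
    refine smul_toComplexMatrix_mem_stripMinusCone (lt_of_le_of_lt ?_ haR)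
    refine mul_le_mul_of_nonneg_right ((Complex.abs_re_le_norm _).trans ?_) (apply_nonneg N R)
    simpa using (mem_ball_zero_iff.1 hz).le
  have hμ : ∀ t : ℝ, charFun ((κ.restrict {X | 1 ≤ N X}).map fun X => (R * X).trace) t =
      H ((t * Complex.I) • toComplexMatrix R) := fun t => by
    rw [hchar, toComplexMatrix_smul, mul_comm, mul_smul, Complex.coe_smul]
  have htrace : Continuous fun X : Matrix (Fin d) (Fin d) ℝ => (R * X).trace := by fun_prop
  have hexp := (integrable_exp_mul_of_charFun_eventuallyEq hG (.of_forall hμ)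
    (r := 1) (by simpa using ha)).comp_measurable htrace.measurable
  simpa [Function.comp_def] using hexp.lintegral_lt_top

end JumpCumulant

theorem lemma2p5_general {d : ℕ} (N : Seminorm ℝ (Matrix (Fin d) (Fin d) ℝ))
    (hN : ∀ X, N X = 0 → X = 0) (γ : Matrix (Fin d) (Fin d) ℝ)
    (κ : Measure (Matrix (Fin d) (Fin d) ℝ)) (hκ : Integrable (fun X => min 1 (N X)) κ)
    (hpsd : ∀ᵐ X ∂κ, X.PosSemidef) (ε : ℝ) :
    IsOpen (stripMinusCone N ε) ∧ Convex ℝ (stripMinusCone N ε) ∧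
      (CumulantAnalyticOn γ κ (stripMinusCone N ε) ↔ FiniteExpMoments N κ ε) ∧
      (CumulantExtendsAnalyticallyTo γ κ (stripMinusCone N ε) ↔ FiniteExpMoments N κ ε) := by
  have hextends : CumulantAnalyticOn γ κ (stripMinusCone N ε) →
      CumulantExtendsAnalyticallyTo γ κ (stripMinusCone N ε) := fun h =>
    ⟨cumulantTransform γ κ, h.2, fun _ => rfl⟩
  have hmoments : CumulantExtendsAnalyticallyTo γ κ (stripMinusCone N ε) →
      FiniteExpMoments N κ ε := fun h => h.finiteExpMoments hN hκ hpsd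
  have hanalytic : FiniteExpMoments N κ ε → CumulantAnalyticOn γ κ (stripMinusCone N ε) :=
    fun h => h.cumulantAnalyticOn hN hκ hpsd
  exact ⟨isOpen_stripMinusCone N ε, convex_stripMinusCone N ε, ⟨hmoments ∘ hextends, hanalytic⟩,
    hmoments, hextends ∘ hanalytic⟩

theorem lemma2p5 {d : ℕ} {Ω : Type*} [MeasurableSpace Ω] (P : Measure Ω) [IsProbabilityMeasure P]
    -- an arbitrary norm on the real matrices
    (N : Seminorm ℝ (Matrix (Fin d) (Fin d) ℝ)) (hN : ∀ X, N X = 0 → X = 0)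
    (L : ℝ≥0 → Ω → Matrix (Fin d) (Fin d) ℝ) (hL : IsMatrixSubordinator L P)
    (γ : Matrix (Fin d) (Fin d) ℝ) (κ : Measure (Matrix (Fin d) (Fin d) ℝ))
    (hγκ : HasDriftAndLevyMeasure N L P γ κ)
    (ε : ℝ) (hε : 0 < ε) :
    IsOpen (stripMinusCone N ε) ∧ Convex ℝ (stripMinusCone N ε) ∧
      (CumulantAnalyticOn γ κ (stripMinusCone N ε) ↔ FiniteExpMoments N κ ε) ∧
      (CumulantExtendsAnalyticallyTo γ κ (stripMinusCone N ε) ↔ FiniteExpMoments N κ ε) :=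
  lemma2p5_general N hN γ κ hγκ.integrable_min_one hγκ.levy_posSemidef ε
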